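/- All graphs are finite and simple. A graph is \emph{cubelike} if it is isomorphic to a Cayley graph $\mathrm{Cay}(\mathbb{Z}_2^n, C)$ for some integer $n \ge 0$ and some $C \subseteq \mathbb{Z}_2^n \setminus \{0\}$, where $a \sim b$ if and only if $a + b \in C$. A graph $X$ is a \emph{core} if every endomorphism of $X$ is a bijection, and $X$ is \emph{the core of} a graph $Z$ if $X$ is a core and there are graph homomorphisms $X \to Z$ and $Z \to X$. The \emph{Clebsch graph} is $\mathrm{Cay}(\mathbb{Z}_2^4, \{e_1, e_2, e_3, e_4, e_1+e_2+e_3+e_4\})$, where $e_1, \dots, e_4$ is the standard basis of $\mathbb{Z}_2^4$. Theorem. Let $X$ be the core of a cubelike graph and suppose that $|V(X)| \le 16$. If $X$ has at least one edge, then $X$ is isomorphic to one of $K_2$, $K_4$, $K_8$, $K_{16}$, the Clebsch graph, or the complement of the Clebsch graph. In every case (that is, also when $X$ has no edges) $X$ is cubelike. -/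

import Mathlib

namespace SimpleGraph

/-- Two graphs are homomorphically equivalent if each maps to the other. -/
def HomEquivalent {V W : Type*} (X : SimpleGraph V) (Y : SimpleGraph W) : Prop :=
  Nonempty (X →g Y) ∧ Nonempty (Y →g X)

/-- A graph is a core if all of its endomorphisms are bijections. -/
def IsCore {V : Type*} (X : SimpleGraph V) : Prop :=
  ∀ φ : X →g X, Function.Bijective φ

/-- `X` is a core of `Y` if `X` is a core and `X` and `Y` are homomorphically equivalent.
For finite graphs such an `X` is unique up to isomorphism. -/
def IsCoreOf {V W : Type*} (X : SimpleGraph V) (Y : SimpleGraph W) : Prop :=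
  X.IsCore ∧ X.HomEquivalent Y

/-- A graph is cubelike if it is (isomorphic to) a Cayley graph `Cay(ℤ₂ⁿ, C)` for some `n` and
some connection set `C` that does not contain `0`. -/
def IsCubelike {V : Type*} (X : SimpleGraph V) : Prop :=
  ∃ (n : ℕ) (C : Set (Fin n → ZMod 2)), 0 ∉ C ∧ Nonempty (X ≃g addCayley C)

/-- The Clebsch graph, i.e. the folded cube of order 5: the Cayley graph of `ℤ₂⁴` with
connection set `{e₁, e₂, e₃, e₄, e₁ + e₂ + e₃ + e₄}`. -/
def clebschGraph : SimpleGraph (Fin 4 → ZMod 2) :=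
  addCayley (Set.range (fun i : Fin 4 => (Pi.single i 1 : Fin 4 → ZMod 2)) ∪
    {∑ i : Fin 4, (Pi.single i 1 : Fin 4 → ZMod 2)})

end SimpleGraph

/-! Let `i : X → Cay` and `p : Cay → X` be homomorphisms. Each map `x ↦ p (i x + g)` is an
endomorphism of the core `X`, hence an automorphism. `CubeFrame` records this trace of the
translations; `toVert` itself need not respect addition. A frame serves the complement equally well.

In a triangle-free framed graph, distinct words in neighbours of the base point with the same
endpoint differ in at least four letters. Hence at most two of the 32 words over five neighbours
share an endpoint, and sixteen vertices force exactly two. A sixth neighbour then makes the graph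
bipartite. Otherwise, if it is not bipartite, an odd closed word uses exactly five neighbours,
complementary words agree, and the graph is the folded 5-cube.

This settles the case where `X` or its complement is triangle-free. If both have triangles,
commutativity enlarges each triangle to a 4-clique; the clique–coclique bound is tight at 16, so `X`
is 4-colourable. A core coloured with as many colours as one of its cliques has vertices is
complete, and `|V|` divides `2 ^ n`. -/

namespace SimpleGraph

open Finset

/-- A frame of a group of exponent two on a graph `Y`: a map `toVert` from the group to the
vertices with a section `lift`, sending `o` to `0`, such that every translate of the section is
carried by `toVert` to an automorphism of `Y`. -/
structure CubeFrame {V : Type*} (Y : SimpleGraph V) (G : Type*) [AddCommGroup G] (o : V) where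
  toVert : G → V
  lift : V → G
  add_self : ∀ g : G, g + g = 0
  lift_base : lift o = 0
  toVert_lift : ∀ x, toVert (lift x) = x
  bijective : ∀ g, Function.Bijective fun x => toVert (g + lift x)
  adj_iff : ∀ g x y, Y.Adj (toVert (g + lift x)) (toVert (g + lift y)) ↔ Y.Adj x y

theorem sum_symmDiff_of_add_self {G ι : Type*} [AddCommGroup G] [DecidableEq ι]
    (h : ∀ g : G, g + g = 0) (f : ι → G) (S T : Finset ι) :
    ∑ i ∈ symmDiff S T, f i = ∑ i ∈ S, f i + ∑ i ∈ T, f i := by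
  have h1 : ∑ i ∈ symmDiff S T, f i = ∑ i ∈ S \ T, f i + ∑ i ∈ T \ S, f i := by
    rw [symmDiff_def, Finset.sup_eq_union, Finset.sum_union]
    exact disjoint_sdiff_sdiff
  have h2 := Finset.sum_inter_add_sum_sdiff S T f
  have h3 := Finset.sum_inter_add_sum_sdiff T S f
  rw [h1, ← h2, ← h3, Finset.inter_comm T S]
  have := h (∑ i ∈ S ∩ T, f i)
  calc _ = (∑ i ∈ S ∩ T, f i + ∑ i ∈ S ∩ T, f i) + (∑ i ∈ S \ T, f i + ∑ i ∈ T \ S, f i) := by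
        rw [this, zero_add]
    _ = _ := by abel

/-! ### Walks and words in framed graphs. -/

namespace CubeFrame

variable {V G : Type*} [AddCommGroup G] {Y : SimpleGraph V} {o : V}

/-- The same frame on the complement. -/
def compl (F : CubeFrame Y G o) : CubeFrame Yᶜ G o where
  __ := F
  adj_iff g x y := by
    rw [compl_adj, compl_adj, F.adj_iff, (F.bijective g).1.ne_iff]

theorem toVert_add_lift_base (F : CubeFrame Y G o) (g : G) :
    F.toVert (g + F.lift o) = F.toVert g := by
  rw [F.lift_base, add_zero]

theorem adj_toVert_iff (F : CubeFrame Y G o) (g : G) (y : V) :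
    Y.Adj (F.toVert g) y ↔ ∃ a, Y.Adj o a ∧ F.toVert (g + F.lift a) = y := by
  constructor
  · intro h
    obtain ⟨a, ha⟩ := (F.bijective g).2 y
    refine ⟨a, ?_, ha⟩
    dsimp only at ha
    rwa [← ha, ← F.toVert_add_lift_base g, F.adj_iff] at h
  · rintro ⟨a, ha, rfl⟩
    rwa [← F.toVert_add_lift_base g, F.adj_iff]

theorem adj_toVert_add (F : CubeFrame Y G o) {a : V} (ha : Y.Adj o a) (g : G) :
    Y.Adj (F.toVert g) (F.toVert (g + F.lift a)) :=
  (F.adj_toVert_iff g _).2 ⟨a, ha, rfl⟩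

/-- Distinct words in neighbours of the base point with the same image are at distance at
least four in a triangle-free graph. -/
theorem four_le_card (F : CubeFrame Y G o) (hY : Y.CliqueFree 3) {ι : Type*} [DecidableEq ι]
    {b : ι → V}
    (hb : b.Injective) (hN : ∀ i, Y.Adj o (b i)) {D : Finset ι} (hD : D.Nonempty) {g : G}
    (h : F.toVert (g + ∑ i ∈ D, F.lift (b i)) = F.toVert g) : 4 ≤ #D := by
  have h0 : #D ≠ 0 := by simpa using hD.ne_empty
  by_contra hlt
  have : #D = 1 ∨ #D = 2 ∨ #D = 3 := by omega
  rcases this with h1 | h1 | h1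
  · obtain ⟨i, rfl⟩ := card_eq_one.1 h1
    rw [sum_singleton] at h
    exact (F.adj_toVert_add (hN i) g).ne h.symm
  · obtain ⟨i, j, hij, rfl⟩ := card_eq_two.1 h1
    rw [sum_pair hij] at h
    have h2 : F.toVert (g + F.lift (b i) + F.lift (b j)) =
        F.toVert (g + F.lift (b i) + F.lift (b i)) := by
      rw [add_assoc, h, add_assoc, F.add_self, add_zero]
    exact hij (hb ((F.bijective _).1 h2)).symm
  · obtain ⟨i, j, k, hij, hik, hjk, rfl⟩ := card_eq_three.1 h1
    rw [sum_insert (by simp [hij, hik]), sum_pair hjk, ← add_assoc, ← add_assoc] at h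
    have e1 := F.adj_toVert_add (hN i) g
    have e2 := F.adj_toVert_add (hN j) (g + F.lift (b i))
    have e3 := F.adj_toVert_add (hN k) (g + F.lift (b i) + F.lift (b j))
    rw [h] at e3
    classical exact hY _ (is3Clique_triple_iff.2 ⟨e1, e3.symm, e2⟩)

/-- Lifting of walks from the base point. -/
theorem exists_word_of_walk (F : CubeFrame Y G o) [DecidableEq V] {x : V} (p : Y.Walk o x) :
    ∃ D : Finset V, (∀ a ∈ D, Y.Adj o a) ∧ #D % 2 = p.length % 2 ∧
      F.toVert (∑ a ∈ D, F.lift a) = x := by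
  suffices H : ∀ {u x : V} (p : Y.Walk u x) (D : Finset V), (∀ a ∈ D, Y.Adj o a) →
      F.toVert (∑ a ∈ D, F.lift a) = u → ∃ D' : Finset V, (∀ a ∈ D', Y.Adj o a) ∧
      #D' % 2 = (#D + p.length) % 2 ∧ F.toVert (∑ a ∈ D', F.lift a) = x by
    obtain ⟨D, h1, h2, h3⟩ := H p ∅ (by simp) (by
      rw [sum_empty, ← F.lift_base, F.toVert_lift])
    exact ⟨D, h1, by simpa using h2, h3⟩
  intro u x p
  induction p with
  | nil => intro D hD h; exact ⟨D, hD, by simp, h⟩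
  | cons hadj p ih =>
    rename_i u v w
    intro D hD h
    rw [← h, F.adj_toVert_iff] at hadj
    obtain ⟨a, ha, hv⟩ := hadj
    -- A repeated letter cancels, so toggling `a` follows the edge and flips the parity.
    have hs : F.toVert (∑ x ∈ symmDiff D {a}, F.lift x) = v := by
      rw [sum_symmDiff_of_add_self F.add_self, sum_singleton, hv]
    obtain ⟨D', h1, h2, h3⟩ := ih (symmDiff D {a}) (by
      intro x hx
      rcases mem_symmDiff.1 hx with hx | hx
      · exact hD x hx.1
      · rw [mem_singleton.1 hx.1]; exact ha) hs
    refine ⟨D', h1, ?_, h3⟩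
    rw [h2, Walk.length_cons]
    by_cases had : a ∈ D
    · have : symmDiff D {a} = D.erase a := by
        ext x; simp only [mem_symmDiff, mem_singleton, mem_erase]
        by_cases hx : x = a <;> simp_all
      rw [this]
      have := card_erase_add_one had
      omega
    · have : symmDiff D {a} = insert a D := by
        ext x; simp only [mem_symmDiff, mem_singleton, mem_insert]
        by_cases hx : x = a <;> simp_all
      rw [this, card_insert_of_notMem had]
      omega

/-- A triangle-free framed graph that is not bipartite has a word of odd length at least five
which returns to the base point. -/
theorem exists_odd_word (F : CubeFrame Y G o) [DecidableEq V] (hY : Y.CliqueFree 3)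
    (h2 : ¬ Y.Colorable 2) : ∃ D : Finset V, (∀ a ∈ D, Y.Adj o a) ∧ 5 ≤ #D ∧
      F.toVert (∑ a ∈ D, F.lift a) = F.toVert 0 := by
  rw [two_colorable_iff_forall_loop_even] at h2
  push Not at h2
  obtain ⟨u, p, hp⟩ := h2
  -- Translation by `lift u` moves the odd loop to the base point.
  let f : Y →g Y := ⟨fun x => F.toVert (F.lift u + F.lift x), fun {x y} h => (F.adj_iff _ x y).2 h⟩
  have hfu : f u = o := by
    change F.toVert (F.lift u + F.lift u) = o
    rw [F.add_self, ← F.lift_base, F.toVert_lift]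
  have h0 : F.toVert 0 = o := by rw [← F.lift_base, F.toVert_lift]
  obtain ⟨D, h1, h3, h4⟩ := F.exists_word_of_walk ((p.map f).copy hfu hfu)
  rw [Walk.length_copy, Walk.length_map, Nat.odd_iff.1 (by simpa using hp : Odd p.length)] at h3
  refine ⟨D, h1, ?_, h4.trans h0.symm⟩
  have hinj : Function.Injective fun a : D => (a : V) := Subtype.val_injective
  have := F.four_le_card hY (D := (univ : Finset D)) (g := 0) hinj (fun i => h1 _ i.2)
    (by
      rw [univ_nonempty_iff]
      have : D.Nonempty := by rw [← card_pos]; omega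
      exact this.to_subtype) (by
      rw [zero_add, sum_coe_sort D (fun a => F.lift a), h4, h0])
  simp at this
  omega

end CubeFrame
-- Hamming distance between subsets.
theorem card_symmDiff_parity {ι : Type*} [DecidableEq ι] (A B C : Finset ι) :
    #(symmDiff A C) % 2 = (#(symmDiff A B) + #(symmDiff B C)) % 2 ∧
      #(symmDiff A C) ≤ #(symmDiff A B) + #(symmDiff B C) := by
  have key : ∀ D E : Finset ι, #(symmDiff D E) + 2 * #(D ∩ E) = #D + #E := fun D E => by
    have h : symmDiff D E = (D \ E) ∪ (E \ D) := rfl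
    rw [h, card_union_of_disjoint disjoint_sdiff_sdiff]
    have h1 := card_sdiff_add_card_inter D E
    have h2 := card_sdiff_add_card_inter E D
    rw [inter_comm E D] at h2
    omega
  have h := key (symmDiff A B) (symmDiff B C)
  have h1 : symmDiff (symmDiff A B) (symmDiff B C) = symmDiff A C := by
    rw [symmDiff_assoc, symmDiff_symmDiff_cancel_left]
  rw [h1] at h
  omega

/-- The triangle inequality for `A` and `C` through the antipode of `B`. -/
theorem card_symmDiff_perimeter {ι : Type*} [DecidableEq ι] [Fintype ι] (A B C : Finset ι) :
    #(symmDiff A B) + #(symmDiff B C) + #(symmDiff A C) ≤ 2 * Fintype.card ι := by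
  have h1 := (card_symmDiff_parity A Bᶜ C).2
  have e1 : symmDiff A Bᶜ = (symmDiff A B)ᶜ := by
    ext x; simp only [mem_symmDiff, mem_compl]; tauto
  have e2 : symmDiff Bᶜ C = (symmDiff B C)ᶜ := by
    ext x; simp only [mem_symmDiff, mem_compl]; tauto
  rw [e1, e2, card_compl, card_compl] at h1
  have := card_le_univ (symmDiff A B)
  have := card_le_univ (symmDiff B C)
  omega

/-! ### Words over five neighbours. -/

namespace CubeFrame

variable {V G : Type*} [AddCommGroup G] {Y : SimpleGraph V} {o : V}

/-- The vertex reached from the base point by the word with support `S`. -/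
def word (F : CubeFrame Y G o) (b : Fin 5 → V) (S : Finset (Fin 5)) : V :=
  F.toVert (∑ i ∈ S, F.lift (b i))

section

variable (F : CubeFrame Y G o) {b : Fin 5 → V}

theorem lift_sum_symmDiff (b : Fin 5 → V) (S T : Finset (Fin 5)) :
    ∑ i ∈ S, F.lift (b i) + ∑ i ∈ symmDiff S T, F.lift (b i) = ∑ i ∈ T, F.lift (b i) := by
  rw [sum_symmDiff_of_add_self F.add_self, ← add_assoc, F.add_self, zero_add]

theorem word_symmDiff_singleton (b : Fin 5 → V) (S : Finset (Fin 5)) (i : Fin 5) :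
    F.word b (symmDiff S {i}) = F.toVert (∑ i ∈ S, F.lift (b i) + F.lift (b i)) := by
  rw [word, sum_symmDiff_of_add_self F.add_self, sum_singleton]

theorem adj_word_symmDiff_singleton (hN : ∀ i, Y.Adj o (b i)) (S : Finset (Fin 5)) (i : Fin 5) :
    Y.Adj (F.word b S) (F.word b (symmDiff S {i})) := by
  rw [word_symmDiff_singleton]
  exact F.adj_toVert_add (hN i) _

theorem four_le_of_word_eq (hY : Y.CliqueFree 3) (hb : b.Injective) (hN : ∀ i, Y.Adj o (b i))
    {S T : Finset (Fin 5)} (hST : S ≠ T) (h : F.word b S = F.word b T) : 4 ≤ #(symmDiff S T) := by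
  refine F.four_le_card hY hb hN (g := ∑ i ∈ S, F.lift (b i)) ?_ ?_
  · rw [nonempty_iff_ne_empty, ← bot_eq_empty, Ne, symmDiff_eq_bot]
    exact hST
  · rw [lift_sum_symmDiff]; exact h.symm

/-- With `a` as a sixth letter the two words differ in at least four letters, one of which is `a`.
-/
theorem three_le_of_word_eq_toVert (hY : Y.CliqueFree 3) (hb : b.Injective)
    (hN : ∀ i, Y.Adj o (b i)) {a : V} (ha : Y.Adj o a) (hab : ∀ i, b i ≠ a)
    {S T : Finset (Fin 5)}
    (h : F.word b T = F.toVert (∑ i ∈ S, F.lift (b i) + F.lift a)) : 3 ≤ #(symmDiff S T) := by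
  let b' : Option (Fin 5) → V := fun x => x.elim a b
  have hb' : b'.Injective := by
    rintro (_ | i) (_ | j) hij
    · rfl
    · exact (hab j hij.symm).elim
    · exact (hab i hij).elim
    · rw [hb hij]
  have hN' : ∀ i, Y.Adj o (b' i) := by rintro (_ | i); exacts [ha, hN i]
  have := F.four_le_card hY hb' hN' (D := insertNone (symmDiff S T))
    (g := ∑ i ∈ S, F.lift (b i) + F.lift a) ⟨none, by simp⟩ (by
      rw [sum_insertNone, ← h]
      change F.toVert (_ + F.lift a + (F.lift a + ∑ i ∈ symmDiff S T, F.lift (b i))) = _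
      rw [add_assoc, ← add_assoc (F.lift a), F.add_self, zero_add, lift_sum_symmDiff]
      rfl)
  rw [card_insertNone] at this
  omega

theorem card_symmDiff_of_adj_word (hY : Y.CliqueFree 3) (hN : ∀ i, Y.Adj o (b i))
    {S T : Finset (Fin 5)} (h : Y.Adj (F.word b S) (F.word b T)) :
    #(symmDiff S T) ≠ 0 ∧ #(symmDiff S T) ≠ 2 := by
  constructor
  · intro h0
    rw [card_eq_zero, ← bot_eq_empty, symmDiff_eq_bot] at h0
    exact h.ne (by rw [h0])
  · intro h2
    obtain ⟨i, j, hij, hD⟩ := card_eq_two.1 h2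
    have hT : T = symmDiff (symmDiff S {i}) {j} := by
      rw [symmDiff_assoc]
      have : symmDiff ({i} : Finset (Fin 5)) {j} = {i, j} := by
        ext x; simp only [mem_symmDiff, mem_singleton, mem_insert]
        constructor
        · tauto
        · rintro (rfl | rfl) <;> simp [hij, hij.symm]
      rw [this, ← hD, symmDiff_symmDiff_cancel_left]
    have e1 := F.adj_word_symmDiff_singleton hN S i
    have e2 := F.adj_word_symmDiff_singleton hN (symmDiff S {i}) j
    rw [← hT] at e2
    classical exact hY _ (is3Clique_triple_iff.2 ⟨e1, h, e2⟩)

/-- Equal endpoints need not survive translation, so letters are toggled one at a time. The edge out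
of `S` along `i` leaves `Sᶜ` along some `k`; if `k ≠ i`, two words with one endpoint would differ in
only three letters. -/
theorem word_compl (hY : Y.CliqueFree 3) (hb : b.Injective)
    (hN : ∀ a, Y.Adj o a ↔ a ∈ Set.range b) (h0 : F.word b univ = F.word b ∅)
    (S : Finset (Fin 5)) : F.word b S = F.word b Sᶜ := by
  have hN' : ∀ i, Y.Adj o (b i) := fun i => (hN _).2 ⟨i, rfl⟩
  have step : ∀ (S : Finset (Fin 5)) (i), F.word b S = F.word b Sᶜ →
      F.word b (symmDiff S {i}) = F.word b (symmDiff S {i})ᶜ := by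
    intro S i h
    have h1 := F.adj_word_symmDiff_singleton hN' S i
    rw [h, word, F.adj_toVert_iff] at h1
    obtain ⟨a, ha, h1⟩ := h1
    obtain ⟨k, rfl⟩ := (hN a).1 ha
    rw [← word_symmDiff_singleton] at h1
    have key : ∀ i k : Fin 5, ∀ S : Finset (Fin 5), symmDiff (symmDiff Sᶜ {k}) (symmDiff S {i}) =
        symmDiff univ (symmDiff {k} {i}) := by
      intro i k S; ext x; simp only [mem_symmDiff, mem_compl, mem_univ]; tauto
    have hne : symmDiff Sᶜ {k} ≠ symmDiff S {i} := by
      rw [Ne, ← symmDiff_eq_bot, key]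
      clear * -; revert i k; decide
    have h2 := F.four_le_of_word_eq hY hb hN' hne h1
    rw [key] at h2
    have hki : k = i := by revert h2; clear * -; revert i k; decide
    rw [← h1, hki]
    congr 1
    ext x; simp only [mem_symmDiff, mem_compl]; tauto
  induction S using Finset.induction_on with
  | empty => rw [← h0, compl_empty]
  | insert i S hi ih =>
    have : insert i S = symmDiff S {i} := by
      ext x; simp only [mem_symmDiff, mem_singleton, mem_insert]
      by_cases hx : x = i <;> simp_all
    rw [this]
    exact step S i ih

variable [Fintype V]

/-- If there are at most sixteen vertices, words over five neighbours hit every vertex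
exactly twice. -/
theorem exists_word_pair (hY : Y.CliqueFree 3) (hcard : Fintype.card V ≤ 16) (hb : b.Injective)
    (hN : ∀ i, Y.Adj o (b i)) (y : V) : ∃ S T, S ≠ T ∧ F.word b S = y ∧ F.word b T = y := by
  classical
  have hle : ∀ z : V, #{S | F.word b S = z} ≤ 2 := by
    intro z
    -- Three words pairwise at distance at least 4 have perimeter at least 12, but 10 is the
    -- maximum.
    by_contra! h
    obtain ⟨S, T, U, hS, hT, hU, h1, h2, h3⟩ := two_lt_card_iff.1 h
    simp only [mem_filter, mem_univ, true_and] at hS hT hU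
    have d1 := F.four_le_of_word_eq hY hb hN h1 (hS.trans hT.symm)
    have d2 := F.four_le_of_word_eq hY hb hN h2 (hS.trans hU.symm)
    have d3 := F.four_le_of_word_eq hY hb hN h3 (hT.trans hU.symm)
    have := card_symmDiff_perimeter S T U
    rw [Fintype.card_fin] at this
    omega
  have hsum : ∑ z : V, #{S | F.word b S = z} = 32 := by
    rw [← card_eq_sum_card_fiberwise (f := F.word b) (s := univ) (t := univ) (by simp)]
    simp
  have hy : #{S | F.word b S = y} = 2 := by
    by_contra hne
    have hlt : ∑ z : V, #{S | F.word b S = z} < ∑ z : V, 2 :=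
      sum_lt_sum (fun z _ => hle z) ⟨y, mem_univ y, lt_of_le_of_ne (hle y) hne⟩
    simp only [sum_const, card_univ, smul_eq_mul] at hlt
    omega
  obtain ⟨S, T, hST, h⟩ := card_eq_two.1 hy
  have hS : S ∈ ({S | F.word b S = y} : Finset _) := by rw [h]; simp
  have hT : T ∈ ({S | F.word b S = y} : Finset _) := by rw [h]; simp
  exact ⟨S, T, hST, by simpa using hS, by simpa using hT⟩

/-- A triangle-free framed graph on at most sixteen vertices is bipartite when its valency is at
least six. -/
theorem colorable_two (F : CubeFrame Y G o) (hY : Y.CliqueFree 3) (hcard : Fintype.card V ≤ 16)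
    (hb : b.Injective) (hN : ∀ i, Y.Adj o (b i)) {a : V} (ha : Y.Adj o a) (hab : ∀ i, b i ≠ a) :
    Y.Colorable 2 := by
  have pair := F.exists_word_pair hY hcard hb hN
  have par := @card_symmDiff_parity (Fin 5) _
  have per : ∀ A B C : Finset (Fin 5),
    #(symmDiff A B) + #(symmDiff B C) + #(symmDiff A C) ≤ 10 := card_symmDiff_perimeter
  have comm : ∀ A B : Finset (Fin 5), #(symmDiff A B) = #(symmDiff B A) := fun A B => by
    rw [symmDiff_comm]
  have far : ∀ {S T}, S ≠ T → F.word b S = F.word b T → 4 ≤ #(symmDiff S T) :=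
    fun hne h => F.four_le_of_word_eq hY hb hN hne h
  -- If `S` and `T` are antipodal, a word for the neighbour along `a` is at distance at least 3 from
  -- `S`, so at most 2 from `T`, and by adjacency exactly 1. The two such words are then too close
  -- together.
  have not_five : ∀ S T, F.word b S = F.word b T → #(symmDiff S T) ≠ 5 := by
    intro S T h h5
    obtain ⟨K, L, hKL, hK, hL⟩ := pair (F.toVert (∑ i ∈ S, F.lift (b i) + F.lift a))
    have near : ∀ K, F.word b K = F.toVert (∑ i ∈ S, F.lift (b i) + F.lift a) →
        #(symmDiff K T) ≤ 1 := by
      intro K hK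
      have h3 := F.three_le_of_word_eq_toVert hY hb hN ha hab hK
      have had : Y.Adj (F.word b T) (F.word b K) := by
        rw [hK, ← h]; exact F.adj_toVert_add ha _
      have h4 := F.card_symmDiff_of_adj_word hY hN had
      have := per S T K
      have := comm T K
      omega
    have := near K hK
    have := near L hL
    have := far hKL (hK.trans hL.symm)
    have := (par K T L).2
    have := comm L T
    omega
  have four : ∀ {S T}, S ≠ T → F.word b S = F.word b T → #(symmDiff S T) = 4 := by
    intro S T hne h
    have := far hne h
    have := not_five S T h
    have := per S T T
    have := comm S T
    omega
  choose w hw using fun y => (pair y).imp fun S h => h.choose_spec.2.1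
  have parity : ∀ S y, F.word b S = y → #S % 2 = #(w y) % 2 := by
    intro S y h
    by_cases hS : S = w y
    · rw [hS]
    · have := four hS (h.trans (hw y).symm)
      have := (par S (w y) ∅).1
      rw [← bot_eq_empty, symmDiff_bot, symmDiff_bot] at this
      omega
  have empt : ∀ S : Finset (Fin 5), symmDiff S ∅ = S := fun S => by
    rw [← bot_eq_empty, symmDiff_bot]
  have step : ∀ y z, Y.Adj y z → #(w y) % 2 ≠ #(w z) % 2 := by
    intro y z hyz
    have hyz' := hyz
    rw [← hw y, word, F.adj_toVert_iff] at hyz'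
    obtain ⟨a', ha', hz⟩ := hyz'
    by_cases hi : ∃ i, b i = a'
    · obtain ⟨i, rfl⟩ := hi
      rw [← word_symmDiff_singleton] at hz
      have h1 := parity _ z hz
      have h2 := (par (w y) (symmDiff (w y) {i}) ∅).1
      rw [empt, empt, symmDiff_symmDiff_cancel_left, card_singleton] at h2
      omega
    · push Not at hi
      -- Both words for `z` are at distance at least 3 from `w y` and 4 from each other; perimeter
      -- 10 makes both distances exactly 3, which is odd.
      obtain ⟨K, L, hKL, hK, hL⟩ := pair z
      have h1 := F.three_le_of_word_eq_toVert hY hb hN ha' hi (hK.trans hz.symm)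
      have h2 := F.three_le_of_word_eq_toVert hY hb hN ha' hi (hL.trans hz.symm)
      have h3 := four hKL (hK.trans hL.symm)
      have h4 := per (w y) K L
      have h5 := (par (w y) K L).1
      have h6 := (par (w y) K ∅).1
      rw [empt, empt] at h6
      have := parity K z hK
      omega
  have C : Y.Coloring Bool := Coloring.mk (fun y => decide (#(w y) % 2 = 0)) (by
    intro y z h he
    have := step y z h
    rw [decide_eq_decide] at he
    omega)
  simpa using C.colorable

end

end CubeFrame
-- The Clebsch graph as a folded 5-cube.
theorem addCayley_adj_of_add_self {G : Type*} [AddCommGroup G] (h : ∀ g : G, g + g = 0) (C : Set G)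
    (h0 : 0 ∉ C) (u v : G) : (addCayley C).Adj u v ↔ u + v ∈ C := by
  have hneg : ∀ g : G, -g = g := fun g => neg_eq_of_add_eq_zero_left (h g)
  rw [addCayley_adj, hneg, hneg, add_comm v u, or_self]
  refine ⟨fun h => h.2, fun hC => ⟨?_, hC⟩⟩
  rintro rfl
  exact h0 (h u ▸ hC)

theorem add_self_zmod_two {ι : Type*} (g : ι → ZMod 2) : g + g = 0 := by
  ext i; exact CharTwo.add_self_eq_zero _

theorem zero_notMem_clebsch : (0 : Fin 4 → ZMod 2) ∉
    (Set.range (fun i : Fin 4 => (Pi.single i 1 : Fin 4 → ZMod 2)) ∪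
    {∑ i : Fin 4, (Pi.single i 1 : Fin 4 → ZMod 2)}) := by
  rintro (⟨i, hi⟩ | h)
  · have := congrFun hi i
    simp at this
  · have := congrFun (Set.mem_singleton_iff.1 h) 0
    simp [Finset.sum_apply] at this

theorem clebschGraph_adj (u v : Fin 4 → ZMod 2) : clebschGraph.Adj u v ↔
    (∃ i, v = u + Pi.single i 1) ∨ v = u + 1 := by
  rw [clebschGraph, addCayley_adj_of_add_self add_self_zmod_two _ zero_notMem_clebsch]
  have hsum : ∑ i : Fin 4, (Pi.single i 1 : Fin 4 → ZMod 2) = 1 := by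
    decide
  have key : ∀ w : Fin 4 → ZMod 2, u + v = w ↔ v = u + w := by
    intro w
    constructor
    · rintro rfl; rw [← add_assoc, add_self_zmod_two, zero_add]
    · rintro rfl; rw [← add_assoc, add_self_zmod_two, zero_add]
  rw [Set.mem_union, Set.mem_range, Set.mem_singleton_iff, hsum, key]
  simp only [← key, eq_comm]

/-- The support of a vector of length four, as a subset of `Fin 5`. -/
def supportFive (v : Fin 4 → ZMod 2) : Finset (Fin 5) :=
  {i | ∃ j : Fin 4, j.castSucc = i ∧ v j = 1}

theorem last_notMem_supportFive (v : Fin 4 → ZMod 2) : Fin.last 4 ∉ supportFive v := by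
  simp only [supportFive, mem_filter, mem_univ, true_and, not_exists, not_and]
  intro j hj
  exact (Fin.castSucc_ne_last j hj).elim

theorem castSucc_mem_supportFive (v : Fin 4 → ZMod 2) (i : Fin 4) :
    i.castSucc ∈ supportFive v ↔ v i = 1 := by
  simp [supportFive]

theorem supportFive_injective : supportFive.Injective := by
  intro u v h
  ext i
  have : u i = 1 ↔ v i = 1 := by
    rw [← castSucc_mem_supportFive, ← castSucc_mem_supportFive, h]
  revert this
  generalize u i = x
  generalize v i = y
  revert x y
  decide

theorem supportFive_add_single (v : Fin 4 → ZMod 2) (i : Fin 4) :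
    supportFive (v + Pi.single i 1) = symmDiff (supportFive v) {i.castSucc} := by
  ext x
  induction x using Fin.lastCases with
  | last =>
    have h : Fin.last 4 ≠ i.castSucc := (Fin.castSucc_ne_last i).symm
    simp only [mem_symmDiff, last_notMem_supportFive, mem_singleton, h, not_false_eq_true,
      and_true, or_self]
  | cast j =>
    rw [mem_symmDiff, castSucc_mem_supportFive, castSucc_mem_supportFive, mem_singleton,
      Fin.castSucc_inj, Pi.add_apply]
    by_cases hj : j = i
    · subst hj
      simp only [Pi.single_eq_same, not_true_eq_false, and_false, true_and, false_or]
      generalize v j = x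
      revert x; decide
    · simp [hj]

/-- Sets avoiding the last letter represent the complementary pairs, so the all-ones vector acts as
the fifth letter. -/
theorem supportFive_add_one (v : Fin 4 → ZMod 2) :
    supportFive (v + 1) = (symmDiff (supportFive v) {Fin.last 4})ᶜ := by
  ext x
  induction x using Fin.lastCases with
  | last =>
    simp only [mem_compl, mem_symmDiff, last_notMem_supportFive, mem_singleton, not_true_eq_false,
      not_false_eq_true, and_true, or_true]
  | cast j =>
    rw [mem_compl, mem_symmDiff, castSucc_mem_supportFive, castSucc_mem_supportFive, mem_singleton,
      Pi.add_apply]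
    have h := Fin.castSucc_ne_last j
    simp only [h, not_false_eq_true, and_true, false_and, or_false, Pi.one_apply]
    generalize v j = x
    revert x; decide

namespace CubeFrame

variable {V G : Type*} [AddCommGroup G] {Y : SimpleGraph V} {o : V} [Fintype V]

theorem nonempty_iso_clebsch_of_word (F : CubeFrame Y G o) {b : Fin 5 → V} (hY : Y.CliqueFree 3)
    (hcard : Fintype.card V ≤ 16) (hb : b.Injective)
    (hN : ∀ a, Y.Adj o a ↔ a ∈ Set.range b) (h0 : F.word b univ = F.word b ∅) :
    Nonempty (Y ≃g clebschGraph) := by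
  have hN' : ∀ i, Y.Adj o (b i) := fun i => (hN _).2 ⟨i, rfl⟩
  have hc := F.word_compl hY hb hN h0
  let f : (Fin 4 → ZMod 2) → V := fun v => F.word b (supportFive v)
  have hf : f.Injective := by
    intro u v h
    by_contra hne
    have h4 := F.four_le_of_word_eq hY hb hN' (supportFive_injective.ne hne) h
    -- The distances from one set to another and to its complement sum to 5, so they cannot both be
    -- at least 4.
    have h5 : #(symmDiff (supportFive u) (supportFive v))ᶜ ≤ 1 := by
      rw [card_compl, Fintype.card_fin]; omega
    have hS : (symmDiff (supportFive u) (supportFive v))ᶜ =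
        symmDiff (supportFive u) (supportFive v)ᶜ := by
      ext x; simp only [mem_symmDiff, mem_compl]; tauto
    rw [hS] at h5
    have hne' : supportFive u ≠ (supportFive v)ᶜ := by
      intro he
      apply last_notMem_supportFive u
      rw [he, mem_compl]
      exact last_notMem_supportFive v
    have h6 := F.four_le_of_word_eq hY hb hN' hne' (h.trans (hc _))
    omega
  have hbij : f.Bijective := by
    refine (Fintype.bijective_iff_injective_and_card f).2 ⟨hf, le_antisymm
      (Fintype.card_le_of_injective f hf) (hcard.trans ?_)⟩
    simp [ZMod.card]
  have hadj : ∀ u v, Y.Adj (f u) (f v) ↔ clebschGraph.Adj u v := by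
    intro u v
    rw [clebschGraph_adj]
    have hs : ∀ i : Fin 4,
        f (u + Pi.single i 1) = F.word b (symmDiff (supportFive u) {i.castSucc}) :=
      fun i => by simp only [f, supportFive_add_single]
    have hl : f (u + 1) = F.word b (symmDiff (supportFive u) {Fin.last 4}) := by
      simp only [f, supportFive_add_one]; rw [← hc]
    constructor
    · intro h
      have h' := h
      simp only [f] at h'
      rw [word, F.adj_toVert_iff] at h'
      obtain ⟨a, ha, h'⟩ := h'
      obtain ⟨i, rfl⟩ := (hN a).1 ha
      rw [← word_symmDiff_singleton] at h'
      induction i using Fin.lastCases with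
      | last => exact Or.inr (hf (h'.symm.trans hl.symm))
      | cast j => exact Or.inl ⟨j, hf (h'.symm.trans (hs j).symm)⟩
    · rintro (⟨i, rfl⟩ | rfl)
      · rw [hs]; exact F.adj_word_symmDiff_singleton hN' _ _
      · rw [hl]; exact F.adj_word_symmDiff_singleton hN' _ _
  exact ⟨RelIso.symm ⟨Equiv.ofBijective f hbij, fun {u v} => hadj u v⟩⟩

/-- A triangle-free framed graph with at most sixteen vertices is bipartite or the Clebsch
graph. -/
theorem colorable_two_or_nonempty_iso_clebsch (F : CubeFrame Y G o) (hY : Y.CliqueFree 3)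
    (hcard : Fintype.card V ≤ 16) : Y.Colorable 2 ∨ Nonempty (Y ≃g clebschGraph) := by
  classical
  by_contra! h
  obtain ⟨h2, hiso⟩ := h
  obtain ⟨D, hD, h5, hr⟩ := F.exists_odd_word hY h2
  obtain ⟨B, hBD, hB⟩ := exists_subset_card_eq h5
  let e : Fin 5 ≃ B := (Fintype.equivFinOfCardEq (by simpa using hB)).symm
  let b : Fin 5 → V := fun i => e i
  have hb : b.Injective := Subtype.val_injective.comp e.injective
  have hmem : ∀ a, a ∈ B ↔ a ∈ Set.range b := by
    intro a
    constructor
    · intro ha; exact ⟨e.symm ⟨a, ha⟩, by simp [b]⟩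
    · rintro ⟨i, rfl⟩; exact (e i).2
  have hNb : ∀ i, Y.Adj o (b i) := fun i => hD _ (hBD (e i).2)
  have hall : ∀ a, Y.Adj o a → a ∈ B := by
    intro a ha
    by_contra haB
    exact h2 (F.colorable_two hY hcard hb hNb ha fun i hi => haB (hi ▸ (e i).2))
  have hDB : D = B := Finset.Subset.antisymm (fun a ha => hall a (hD a ha)) hBD
  refine hiso.false (F.nonempty_iso_clebsch_of_word hY hcard hb
    (fun a => ⟨fun ha => (hmem a).1 (hall a ha), ?_⟩) ?_).some
  · rintro ⟨i, rfl⟩; exact hNb i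
  · rw [word, word, sum_empty, ← hr, hDB]
    congr 1
    rw [← sum_coe_sort B]
    exact Equiv.sum_comp e fun a : B => F.lift a

end CubeFrame
-- Cores and their frames.
-- On a finite vertex set the inverse is a power of `f`, hence also a homomorphism.
theorem Hom.adj_iff_of_bijective {V : Type*} [Finite V] {X : SimpleGraph V} (f : X →g X)
    (hf : Function.Bijective f) (x y : V) : X.Adj (f x) (f y) ↔ X.Adj x y := by
  refine ⟨fun h => ?_, fun h => f.map_adj h⟩
  let e : Equiv.Perm V := Equiv.ofBijective f hf
  have hpow : ∀ k : ℕ, ∀ u v, X.Adj u v → X.Adj ((e ^ k) u) ((e ^ k) v) := by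
    intro k
    induction k with
    | zero => simp
    | succ k ih => intro u v h; rw [pow_succ]; exact ih _ _ (f.map_adj h)
  have := hpow (orderOf e - 1) _ _ h
  have he : ∀ u, (e ^ (orderOf e - 1)) (f u) = u := fun u => by
    change (e ^ (orderOf e - 1) * e) u = u
    rw [← pow_succ, Nat.sub_add_cancel (orderOf_pos e), pow_orderOf_eq_one]
    rfl
  rwa [he, he] at this

/-- The core of a Cayley graph of an elementary abelian 2-group carries a frame. -/
theorem IsCore.nonempty_cubeFrame {V G : Type*} [Finite V] [AddCommGroup G] {X : SimpleGraph V}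
    (hX : X.IsCore) (h2 : ∀ g : G, g + g = 0) {C : Set G} (h0 : 0 ∉ C)
    (i : X →g addCayley C) (p : addCayley C →g X) (o : V) : Nonempty (CubeFrame X G o) := by
  let φ : G → X →g X := fun g => ⟨fun x => p (i x + g), fun {x y} h => p.map_adj (by
    rw [addCayley_adj_of_add_self h2 C h0]
    have := (addCayley_adj_of_add_self h2 C h0 _ _).1 (i.map_adj h)
    rwa [add_add_add_comm, h2, add_zero])⟩
  -- `φ 0` need not be the identity; composing with its inverse makes `lift` a section.
  let s : V ≃ V := Equiv.ofBijective (φ 0) (hX _)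
  have hs : ∀ x y, X.Adj (s.symm x) (s.symm y) ↔ X.Adj x y := fun x y => by
    rw [← (φ 0).adj_iff_of_bijective (hX _)]
    change X.Adj (s (s.symm x)) (s (s.symm y)) ↔ _
    rw [s.apply_symm_apply, s.apply_symm_apply]
  have hshift : ∀ g x, s.symm (p (i o + (g + (i x + i o)))) = s.symm (φ g x) := by
    intro g x
    change _ = s.symm (p (i x + g))
    congr 2
    rw [show i o + (g + (i x + i o)) = (i x + g) + (i o + i o) by abel, h2, add_zero]
  refine ⟨⟨fun g => s.symm (p (i o + g)), fun x => i x + i o, h2, h2 _, fun x => ?_, fun g => ?_,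
    fun g x y => ?_⟩⟩
  · have := hshift 0 x
    rw [zero_add] at this
    rw [this]
    exact s.symm_apply_apply x
  · simp only [hshift]
    exact s.symm.bijective.comp (hX (φ g))
  · rw [hshift, hshift, hs, (φ g).adj_iff_of_bijective (hX _)]

/-- The colouring folds `X` into `K`, and this endomorphism must be surjective. -/
theorem IsCore.eq_top_of_colorable {V : Type*} {X : SimpleGraph V} (hX : X.IsCore) {K : Finset V}
    (hK : X.IsClique K) (hc : X.Colorable #K) : X = ⊤ := by
  obtain ⟨c⟩ := hc
  let e := K.equivFin.symm
  let f : X →g X := ⟨fun x => e (c x), fun {x y} h => hK (e _).2 (e _).2 fun he =>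
    c.valid h (e.injective (Subtype.ext he))⟩
  have hu : ∀ x, x ∈ K := fun x => by
    obtain ⟨y, rfl⟩ := (hX f).2 x
    exact (e (c y)).2
  ext x y
  exact ⟨fun h => h.ne, fun h => hK (hu x) (hu y) h⟩

/-! ### Cliques and cocliques in framed graphs. -/

namespace CubeFrame

variable {V G : Type*} [AddCommGroup G] {Y : SimpleGraph V} {o : V}

theorem toVert_zero (F : CubeFrame Y G o) : F.toVert 0 = o := by
  rw [← F.lift_base, F.toVert_lift]

/-- Every triangle yields a clique on four vertices. -/
theorem exists_isNClique_four (F : CubeFrame Y G o) (h : ¬ Y.CliqueFree 3) :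
    ∃ K : Finset V, Y.IsNClique 4 K := by
  classical
  simp only [CliqueFree, not_forall, not_not] at h
  obtain ⟨T, hT⟩ := h
  obtain ⟨u, v, w, huv, huw, hvw, -⟩ := is3Clique_iff.1 hT
  have hu : F.toVert (F.lift u + F.lift u) = o := by rw [F.add_self, F.toVert_zero]
  obtain ⟨a, ha⟩ : ∃ a, a = F.toVert (F.lift u + F.lift v) := ⟨_, rfl⟩
  obtain ⟨b, hb⟩ : ∃ b, b = F.toVert (F.lift u + F.lift w) := ⟨_, rfl⟩
  have hoa : Y.Adj o a := by rw [← hu, ha, F.adj_iff]; exact huv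
  have hob : Y.Adj o b := by rw [← hu, hb, F.adj_iff]; exact huw
  have hab : Y.Adj a b := by rw [ha, hb, F.adj_iff]; exact hvw
  -- The fourth vertex is the word `a + b`: translation by `lift a` sends `a` to `o` and `b` to it.
  have h1 : Y.Adj o (F.toVert (F.lift a + F.lift b)) := by
    have := (F.adj_iff (F.lift a) a b).2 hab
    rwa [F.add_self, F.toVert_zero] at this
  have h2 : Y.Adj a (F.toVert (F.lift a + F.lift b)) := by
    have := (F.adj_iff (F.lift a) o b).2 hob
    rwa [F.toVert_add_lift_base, F.toVert_lift] at this
  have h3 : Y.Adj b (F.toVert (F.lift a + F.lift b)) := by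
    have := (F.adj_iff (F.lift b) o a).2 hoa
    rwa [F.toVert_add_lift_base, F.toVert_lift, add_comm] at this
  refine ⟨{o, a, b, F.toVert (F.lift a + F.lift b)}, ?_⟩
  refine (is3Clique_triple_iff.2 ⟨hab, h2, h3⟩).insert ?_
  simp only [mem_insert, mem_singleton]
  rintro x (rfl | rfl | rfl)
  exacts [hoa, hob, h1]

variable [Fintype V]

/-- Double counting pairs `(g, x)` whose image is `o`: each `g` has one `x`, and each `x` has as
many `g` as the fibre over `o`. -/
theorem card_dvd (F : CubeFrame Y G o) [Fintype G] : Fintype.card V ∣ Fintype.card G := by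
  classical
  have h1 : ∀ g : G, #{x | F.toVert (g + F.lift x) = o} = 1 := fun g => by
    obtain ⟨x, hx, hu⟩ := (F.bijective g).existsUnique o
    exact card_eq_one.2 ⟨x, by
      ext y; simp only [mem_filter, mem_univ, true_and, mem_singleton]
      exact ⟨fun h => hu y h, fun h => h ▸ hx⟩⟩
  have h2 : ∀ x : V, #{g | F.toVert (g + F.lift x) = o} = #{g | F.toVert g = o} := fun x =>
    card_equiv (Equiv.addRight (F.lift x)) (by simp)
  have h := sum_card_bipartiteAbove_eq_sum_card_bipartiteBelow (s := (univ : Finset G))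
    (t := (univ : Finset V)) fun g x => F.toVert (g + F.lift x) = o
  simp only [bipartiteAbove, bipartiteBelow, h1, h2, sum_const, card_univ, smul_eq_mul,
    mul_one] at h
  exact ⟨_, h⟩

/-- The clique–coclique bound; equality gives a colouring by the clique. -/
theorem card_mul_card_le (F : CubeFrame Y G o) {K I : Finset V} (hK : Y.IsClique K)
    (hI : Yᶜ.IsClique I) :
    #K * #I ≤ Fintype.card V ∧ (#K * #I = Fintype.card V → Y.Colorable #K) := by
  classical
  -- Double count pairs `(a, k)`: a translate of `K` meets the coclique at most once.
  have h1 : ∀ a : V, #{k ∈ K | F.toVert (F.lift a + F.lift k) ∈ I} ≤ 1 := fun a => by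
    rw [card_le_one]
    intro k hk l hl
    rw [mem_filter] at hk hl
    by_contra hne
    have hadj := (F.adj_iff (F.lift a) k l).2 (hK hk.1 hl.1 hne)
    exact ((compl_adj _ _ _).1 (hI hk.2 hl.2 hadj.ne)).2 hadj
  have h2 : ∀ k : V, #{a | F.toVert (F.lift a + F.lift k) ∈ I} = #I := fun k => by
    simp only [add_comm _ (F.lift k)]
    exact card_equiv (Equiv.ofBijective _ (F.bijective (F.lift k))) (by simp)
  have h := sum_card_bipartiteAbove_eq_sum_card_bipartiteBelow (s := (univ : Finset V))
    (t := K) fun a k => F.toVert (F.lift a + F.lift k) ∈ I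
  simp only [bipartiteAbove, bipartiteBelow, h2, sum_const, smul_eq_mul] at h
  have h3 : ∑ a : V, 1 = Fintype.card V := by simp
  refine ⟨by rw [← h, ← h3]; exact sum_le_sum fun a _ => h1 a, fun heq => ?_⟩
  rw [← h, ← h3, sum_eq_sum_iff_of_le fun a _ => h1 a] at heq
  -- At equality each translate meets `I` exactly once; the `k` responsible colours `a`.
  have hex : ∀ a : V, ∃ k : K, F.toVert (F.lift a + F.lift k) ∈ I := fun a => by
    obtain ⟨k, hk⟩ := card_eq_one.1 (heq a (mem_univ a))
    have : k ∈ K.filter fun k => F.toVert (F.lift a + F.lift k) ∈ I := by rw [hk]; simp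
    rw [mem_filter] at this
    exact ⟨⟨k, this.1⟩, this.2⟩
  choose c hc using hex
  have C : Y.Coloring K := Coloring.mk c (by
    intro a b hab he
    have ha := hc a
    have hb := hc b
    rw [← he, add_comm] at hb
    rw [add_comm] at ha
    have hadj := (F.adj_iff (F.lift (c a)) a b).2 hab
    exact ((compl_adj _ _ _).1 (hI ha hb hadj.ne)).2 hadj)
  simpa using C.colorable

theorem eq_top_or_clebsch_or_compl_clebsch (F : CubeFrame Y G o) (hY : Y.IsCore)
    (hcard : Fintype.card V ≤ 16) (hne : Y ≠ ⊥) :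
    Y = ⊤ ∨ Nonempty (Y ≃g clebschGraph) ∨ Nonempty (Y ≃g clebschGraphᶜ) := by
  classical
  by_cases h3 : Y.CliqueFree 3
  · rcases F.colorable_two_or_nonempty_iso_clebsch h3 hcard with h | h
    · obtain ⟨u, v, huv⟩ := ne_bot_iff_exists_adj.1 hne
      refine Or.inl (hY.eq_top_of_colorable (K := {u, v}) ?_ (by rwa [card_pair huv.ne]))
      simpa using fun _ => huv
    · exact Or.inr (Or.inl h)
  by_cases h3' : Yᶜ.CliqueFree 3
  · rcases F.compl.colorable_two_or_nonempty_iso_clebsch h3' hcard with ⟨⟨c⟩⟩ | ⟨⟨e⟩⟩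
    · left
      by_contra htop
      obtain ⟨u, v, huv⟩ : ∃ u v, Yᶜ.Adj u v := by
        rw [← ne_bot_iff_exists_adj]
        simpa using htop
      have hI : Yᶜ.IsClique (({u, v} : Finset V) : Set V) := by
        rw [coe_pair, isClique_pair]; exact fun _ => huv
      have hcl : ∀ i, Y.IsClique (({x | c x = i} : Finset V) : Set V) := by
        intro i x hx y hy hxy
        simp only [coe_filter, mem_univ, true_and, Set.mem_ofPred_eq] at hx hy
        by_contra hadj
        exact c.valid ((compl_adj _ _ _).2 ⟨hxy, hadj⟩) (hx.trans hy.symm)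
      -- Each of the two colour classes is a clique with at most half the vertices, so both have
      -- exactly half and the bound is tight.
      have hb := fun i => F.card_mul_card_le (hcl i) hI
      rw [card_pair huv.ne] at hb
      have hsum := card_eq_sum_card_fiberwise (f := c) (s := univ) (t := univ) (by simp)
      rw [Fin.sum_univ_two, card_univ] at hsum
      have h0 := (hb 0).1
      have h1 := (hb 1).1
      exact htop (hY.eq_top_of_colorable (hcl 0) ((hb 0).2 (by omega)))
    · exact Or.inr (Or.inr ⟨e.toEquiv, fun {x y} => by
        have := e.map_adj_iff (v := x) (w := y)
        rw [compl_adj] at this ⊢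
        change _ ∧ ¬ clebschGraph.Adj (e x) (e y) ↔ _
        rw [this]
        have hxy : e.toEquiv x ≠ e.toEquiv y ↔ x ≠ y := e.toEquiv.injective.ne_iff
        rw [hxy]
        constructor
        · rintro ⟨h1, h2⟩; by_contra h; exact h2 ⟨h1, h⟩
        · intro h; exact ⟨h.ne, fun h' => h'.2 h⟩⟩)
  · obtain ⟨K, hK⟩ := F.exists_isNClique_four h3
    obtain ⟨I, hI⟩ := F.compl.exists_isNClique_four h3'
    obtain ⟨h1, h2⟩ := F.card_mul_card_le hK.isClique hI.isClique
    refine Or.inl (hY.eq_top_of_colorable hK.isClique (h2 ?_))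
    rw [hK.card_eq, hI.card_eq] at h1 ⊢
    omega

end CubeFrame

/-! ### Cubelike graphs and the classification. -/

theorem isCubelike_clebschGraph : clebschGraph.IsCubelike :=
  ⟨4, _, zero_notMem_clebsch, ⟨Iso.refl⟩⟩

theorem IsCubelike.compl {V : Type*} {X : SimpleGraph V} (h : X.IsCubelike) : Xᶜ.IsCubelike := by
  obtain ⟨n, C, h0, ⟨e⟩⟩ := h
  refine ⟨n, Cᶜ \ {0}, fun h => h.2 rfl, ⟨e.toEquiv, fun {x y} => ?_⟩⟩
  have h1 := e.map_adj_iff (v := x) (w := y)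
  rw [addCayley_adj_of_add_self add_self_zmod_two C h0] at h1
  rw [addCayley_adj_of_add_self add_self_zmod_two _ (fun h => h.2 rfl), compl_adj, ← h1]
  have hxy : e x + e y ≠ 0 ↔ x ≠ y := by
    rw [← e.injective.ne_iff, Ne, Ne, not_iff_not]
    constructor
    · intro h
      calc e x = e x + (e y + e y) := by rw [add_self_zmod_two, add_zero]
        _ = e y := by rw [← add_assoc, h, zero_add]
    · intro h; rw [h, add_self_zmod_two]
  rw [← hxy, and_comm]
  rfl

theorem IsCubelike.of_iso {V W : Type*} {X : SimpleGraph V} {Y : SimpleGraph W}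
    (h : Y.IsCubelike) (e : X ≃g Y) : X.IsCubelike := by
  obtain ⟨n, C, h0, ⟨e'⟩⟩ := h
  exact ⟨n, C, h0, ⟨e.trans e'⟩⟩

theorem isCubelike_top {V : Type*} [Fintype V] {k : ℕ} (h : Fintype.card V = 2 ^ k) :
    (⊤ : SimpleGraph V).IsCubelike := by
  refine ⟨k, {0}ᶜ, by simp, ?_⟩
  rw [addCayley_compl_singleton_zero]
  exact ⟨Iso.completeGraph (Fintype.equivOfCardEq (by simp [h, ZMod.card]))⟩

end SimpleGraph

theorem mainTheorem5 {V W : Type*} [Fintype V] (X : SimpleGraph V) (Z : SimpleGraph W)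
    (hZ : Z.IsCubelike) (hX : X.IsCoreOf Z) (hcard : Fintype.card V ≤ 16) :
    (X ≠ ⊥ →
      Nonempty (X ≃g (⊤ : SimpleGraph (Fin 2))) ∨
      Nonempty (X ≃g (⊤ : SimpleGraph (Fin 4))) ∨
      Nonempty (X ≃g (⊤ : SimpleGraph (Fin 8))) ∨
      Nonempty (X ≃g (⊤ : SimpleGraph (Fin 16))) ∨
      Nonempty (X ≃g SimpleGraph.clebschGraph) ∨
      Nonempty (X ≃g SimpleGraph.clebschGraphᶜ)) ∧
    X.IsCubelike := by
  obtain ⟨n, C, h0, ⟨e⟩⟩ := hZ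
  obtain ⟨hcore, ⟨i⟩, ⟨p⟩⟩ := hX
  let o : V := p (e.symm 0)
  obtain ⟨F⟩ := hcore.nonempty_cubeFrame SimpleGraph.add_self_zmod_two h0 (e.toHom.comp i)
    (p.comp e.symm.toHom) o
  by_cases hbot : X = ⊥
  · refine ⟨fun h => (h hbot).elim, ?_⟩
    have hsub : Subsingleton V := by
      refine ⟨fun x y => ?_⟩
      -- Constant maps are endomorphisms of an edgeless graph.
      have := (hcore ⟨fun _ => x, fun {u v} h => by rw [hbot] at h; exact h.elim⟩).2 y
      exact this.choose_spec
    have : X = ⊤ := by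
      ext x y
      simp [Subsingleton.elim x y]
    rw [this]
    exact SimpleGraph.isCubelike_top (k := 0) (by
      rw [pow_zero, Fintype.card_eq_one_iff]
      exact ⟨o, fun y => Subsingleton.elim y o⟩)
  rcases F.eq_top_or_clebsch_or_compl_clebsch hcore hcard hbot with htop | ⟨⟨f⟩⟩ | ⟨⟨f⟩⟩
  · have hdvd := F.card_dvd
    rw [Fintype.card_fun, ZMod.card, Fintype.card_fin, Nat.dvd_prime_pow Nat.prime_two] at hdvd
    obtain ⟨k, -, hk⟩ := hdvd
    subst htop
    refine ⟨fun _ => ?_, SimpleGraph.isCubelike_top hk⟩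
    have hiso : ∀ m, Fintype.card V = m →
        Nonempty ((⊤ : SimpleGraph V) ≃g (⊤ : SimpleGraph (Fin m))) :=
      fun m hm => ⟨SimpleGraph.Iso.completeGraph (Fintype.equivFinOfCardEq hm)⟩
    have hk4 : k ≤ 4 := by
      by_contra! hlt
      have := Nat.pow_le_pow_right (n := 2) (by norm_num) hlt
      omega
    interval_cases k
    · refine (hbot ?_).elim
      have := (Fintype.card_le_one_iff_subsingleton (α := V)).1 hk.le
      ext x y
      simp [Subsingleton.elim x y]
    · exact Or.inl (hiso 2 hk)
    · exact Or.inr (Or.inl (hiso 4 hk))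
    · exact Or.inr (Or.inr (Or.inl (hiso 8 hk)))
    · exact Or.inr (Or.inr (Or.inr (Or.inl (hiso 16 hk))))
  · exact ⟨fun _ => by tauto, SimpleGraph.isCubelike_clebschGraph.of_iso f⟩
  · exact ⟨fun _ => by tauto, SimpleGraph.isCubelike_clebschGraph.compl.of_iso f⟩
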